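/- All graphs are finite and simple. Let $K_3$ denote the triangle, and let $K_{1,3}^{**}$ denote the graph on six vertices $c, a_1, a_2, a_3, b_1, b_2$ with edge set $\{ca_1, ca_2, ca_3, a_1b_1, a_2b_2\}$ (the claw $K_{1,3}$ with two of its three edges prolonged by a pendant vertex). A graph is $\{K_{1,3}^{**}, K_3\}$-free if it contains neither $K_{1,3}^{**}$ nor $K_3$ as an induced subgraph, and a cycle $C$ of a graph $G$ is dominating if every edge of $G$ is incident with a vertex of $C$. Theorem. Let $G$ be a $2$-connected $\{K_{1,3}^{**}, K_3\}$-free graph. Then some longest cycle of $G$ is dominating, that is, $G$ has a cycle $C$ such that no cycle of $G$ is longer than $C$ and every edge of $G$ is incident with a vertex of $C$. -/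

import Mathlib

namespace SimpleGraph

/-- The graph `K_{1,3}^{**}`: a claw with centre `0` and leaves `1`, `2`, `3`, in which the two edges
`01` and `02` are prolonged by new pendant vertices `4` and `5`, respectively. -/
def clawStarStar : SimpleGraph (Fin 6) :=
  SimpleGraph.fromEdgeSet {s(0, 1), s(0, 2), s(0, 3), s(1, 4), s(2, 5)}

/-- `G` is `2`-connected: it has more than two vertices, and `G - X` is connected for every set `X`
of fewer than two vertices. -/
def IsTwoConnected {V : Type*} (G : SimpleGraph V) : Prop :=
  2 < Nat.card V ∧ ∀ X : Set V, X.encard < 2 → (G.induce Xᶜ).Connected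

/-- `G` is `H`-free: `H` is not (isomorphic to) an induced subgraph of `G`. -/
def IsInducedFree {V W : Type*} (G : SimpleGraph V) (H : SimpleGraph W) : Prop :=
  ¬ H.IsIndContained G

namespace Walk

/-- The closed walk `C` is a longest cycle of `G`. -/
def IsLongestCycle {V : Type*} {G : SimpleGraph V} {u : V} (C : G.Walk u u) : Prop :=
  C.IsCycle ∧ ∀ (v : V) (D : G.Walk v v), D.IsCycle → D.length ≤ C.length

/-- Every edge of `G` is incident with a vertex of `C`. -/
def IsDominating {V : Type*} {G : SimpleGraph V} {u : V} (C : G.Walk u u) : Prop :=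
  ∀ e ∈ G.edgeSet, ∃ v ∈ C.support, v ∈ e

end Walk

end SimpleGraph

/-! Among the longest cycles take one, with vertex set `S`, that leaves the fewest edges disjoint
from it. Suppose such an edge remains and let `H` be the component of `G - S` containing it. In a
triangle-free graph, forbidding the prolonged claw becomes a rule (`ClawTriFree.claw`): every
neighbour of the centre of an induced five-vertex path is adjacent to an end of that path.

Call a vertex of `S` with a neighbour in `H` an attachment. As `H` has an edge, an attachment always
starts a path two steps into `H`, which serves as half of such an induced path. Combining the rule
with detours of the cycle through `H` shows that attachments are pairwise nonadjacent and have no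
common neighbour outside `H` (`OffComponent.sparseAttach`). Where a detour only trades one vertex
for one, the second choice of the cycle decides.

Now let `u`, `v` be attachments at least distance `k` apart outside `H`, with `k` minimal; so `k ≥
3`. The rule forces the graph on `S` to be a chain of independent sets from `{u}` to `{v}`,
consecutive inner ones completely joined, and `u`, `v` are the only attachments. In such a chain one
`u`–`v` arc of the cycle can be pushed, two vertices at a time, into the other arc, so at most one
vertex is lost (`ChainLabelling.exists_absorb`). By 2-connectedness some `u`–`v` path through `H`
has at least two inner vertices, and replacing the emptied arc by it gives a longer cycle. -/

namespace SimpleGraph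

variable {V : Type*} {G : SimpleGraph V}

/-! ### Walks and cycles as vertex lists -/

/-- `G.Link a l b`: the list `l` is the interior of a walk of `G` from `a` to `b`. -/
def Link (G : SimpleGraph V) (a : V) (l : List V) (b : V) : Prop :=
  List.IsChain G.Adj (a :: (l ++ [b]))

@[simp] lemma link_nil {a b : V} : G.Link a [] b ↔ G.Adj a b := by simp [Link]

@[simp] lemma link_cons {a b c : V} {l : List V} :
    G.Link a (c :: l) b ↔ G.Adj a c ∧ G.Link c l b := by simp [Link]

@[simp] lemma link_append_cons {a b c : V} {l m : List V} :
    G.Link a (l ++ c :: m) b ↔ G.Link a l c ∧ G.Link c m b := by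
  have := List.isChain_split (R := G.Adj) (c := c) (l₁ := a :: l) (l₂ := m ++ [b])
  simpa [Link] using this

lemma link_append_singleton {a b c : V} {l : List V} :
    G.Link a (l ++ [c]) b ↔ G.Link a l c ∧ G.Adj c b := by simp

lemma Link.reverse {a b : V} {l : List V} (h : G.Link a l b) : G.Link b l.reverse a := by
  have : (a :: (l ++ [b])).reverse.IsChain G.Adj := by
    rw [List.isChain_reverse]
    exact h.imp fun _ _ h => h.symm
  simpa [Link] using this

/-- `G.Cyc a l`: the vertices `a :: l`, in this order, form a cycle of `G`. -/
structure Cyc (G : SimpleGraph V) (a : V) (l : List V) : Prop where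
  link : G.Link a l a
  nodup : (a :: l).Nodup
  two_le : 2 ≤ l.length

lemma Cyc.rotate {a b : V} {l m : List V} (h : G.Cyc a (l ++ b :: m)) : G.Cyc b (m ++ a :: l) := by
  obtain ⟨h1, h2, h3⟩ := h
  refine ⟨?_, ?_, ?_⟩
  · simp at h1 ⊢
    tauto
  · refine List.Perm.nodup (l := a :: (l ++ b :: m)) ?_ h2
    rw [← List.cons_append, ← List.cons_append]
    exact List.perm_append_comm
  · simp at h3 ⊢
    omega

lemma Cyc.reverse {a : V} {l : List V} (h : G.Cyc a l) : G.Cyc a l.reverse := by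
  obtain ⟨h1, h2, h3⟩ := h
  exact ⟨h1.reverse, by simpa using h2, by simpa using h3⟩

lemma Link.exists_walk {a b : V} {l : List V} (h : G.Link a l b) :
    ∃ p : G.Walk a b, p.support = a :: (l ++ [b]) := by
  induction l generalizing a with
  | nil => exact ⟨(link_nil.1 h).toWalk, rfl⟩
  | cons c l ih =>
    obtain ⟨h1, h2⟩ := link_cons.1 h
    obtain ⟨p, hp⟩ := ih h2
    exact ⟨Walk.cons h1 p, by simp [hp]⟩

lemma Cyc.exists_walk {a : V} {l : List V} (h : G.Cyc a l) :
    ∃ p : G.Walk a a, p.IsCycle ∧ p.support = a :: (l ++ [a]) := by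
  obtain ⟨h1, h2, h3⟩ := h
  obtain ⟨b, m, rfl⟩ : ∃ b m, l = b :: m := by
    cases l with
    | nil => simp at h3
    | cons b m => exact ⟨b, m, rfl⟩
  obtain ⟨h4, h5⟩ := link_cons.1 h1
  obtain ⟨p, hp⟩ := h5.exists_walk
  have hP : p.IsPath := by
    rw [Walk.isPath_def, hp]
    simp only [List.nodup_cons, List.nodup_append, List.mem_cons, List.mem_append] at h2 ⊢
    grind
  refine ⟨Walk.cons h4 p, ?_, by simp [hp]⟩
  rw [Walk.isCycle_def, Walk.isTrail_def]
  refine (Walk.cons_isCycle_iff p h4).2 ⟨hP, fun he => ?_⟩ |> (Walk.isCycle_def _).1 |> fun h => ⟨h.1.edges_nodup, h.2⟩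
  -- A path from `b` to `a` that uses the edge `ba` is that edge alone, which would leave the cycle
  -- too short.
  have hl : p.length = 1 := by
    by_contra hne
    have hlen : p.length = m.length + 1 := by
      have := congrArg List.length hp
      simp at this
      omega
    rw [Sym2.eq_swap] at he
    cases p with
    | nil => simp at hp
    | cons hadj q =>
      rename_i c
      rw [Walk.edges_cons, List.mem_cons] at he
      rw [Walk.cons_isPath_iff] at hP
      rcases he with he | he
      · have hc : c = a := by
          have := Sym2.eq_iff.1 he
          rcases this with ⟨_, h⟩ | ⟨h, h'⟩
          · exact h.symm
          · exact absurd h4 (by rw [h']; simp)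
        subst hc
        have := Walk.length_eq_zero_iff.2 (Walk.isPath_iff_nil.1 hP.1)
        simp [this] at hne
      · exact hP.2 (Walk.fst_mem_support_of_mem_edges _ he)
  have := congrArg List.length hp
  simp at this h3
  omega

lemma cyc_of_isCycle {a : V} {p : G.Walk a a} (hp : p.IsCycle) :
    ∃ l, G.Cyc a l ∧ p.support = a :: (l ++ [a]) := by
  have hne := hp.ne_nil
  have hchain := p.isChain_adj_support
  have hn := hp.support_nodup
  have h3 := hp.three_le_length
  have hlast : p.support.tail ≠ [] := by
    intro h
    have := congrArg List.length h
    simp only [List.length_tail, Walk.length_support, List.length_nil] at this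
    omega
  have h1 : p.support = a :: (p.support.tail.dropLast ++ [a]) := by
    conv_lhs => rw [← Walk.cons_tail_support]
    congr 1
    conv_lhs => rw [← List.dropLast_append_getLast hlast]
    congr 2
    rw [List.getLast_tail]
    exact p.getLast_support
  refine ⟨p.support.tail.dropLast, ⟨?_, ?_, ?_⟩, h1⟩
  · unfold Link
    rw [← h1]
    exact hchain
  · rw [h1] at hn
    simp only [List.tail_cons] at hn
    exact (List.perm_append_singleton _ _).nodup hn
  · have := congrArg List.length h1
    simp only [Walk.length_support, List.length_cons, List.length_append, List.length_nil] at this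
    omega

/-- Otherwise `G` is a tree with a leaf; deleting the leaf's neighbour separates the leaf from a
third vertex. -/
lemma exists_cyc [Finite V] (hconn : G.IsTwoConnected) : ∃ a l, G.Cyc a l := by
  classical
  have := Fintype.ofFinite V
  obtain ⟨hcard, hX⟩ := hconn
  have hc : G.Connected := by
    have h := hX ∅ (by simp)
    have hu : (∅ : Set V)ᶜ = Set.univ := Set.compl_empty
    rw [hu] at h
    exact (Iso.connected_iff G.induceUnivIso).1 h
  have : Nontrivial V := by
    rw [← Finite.one_lt_card_iff_nontrivial]
    omega
  have hnot : ¬ G.IsAcyclic := by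
    intro hac
    obtain ⟨v, hv⟩ := (IsTree.mk hc hac).exists_vert_degree_one_of_nontrivial
    obtain ⟨w, hw, hw'⟩ := degree_eq_one_iff_existsUnique_adj.1 hv
    have hX' := hX {w} (by simp)
    obtain ⟨z, hz⟩ : ∃ z, z ∉ ({v, w} : Finset V) := by
      by_contra! h
      have : Fintype.card V ≤ ({v, w} : Finset V).card :=
        Finset.card_le_card (fun x _ => h x)
      rw [Nat.card_eq_fintype_card] at hcard
      have := Finset.card_le_two (a := v) (b := w)
      omega
    simp only [Finset.mem_insert, Finset.mem_singleton, not_or] at hz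
    obtain ⟨p⟩ := hX'.preconnected ⟨v, by simpa using hw.ne⟩ ⟨z, by simpa using hz.2⟩
    cases p with
    | nil => exact hz.1 rfl
    | cons h q =>
      rename_i c
      exact c.2 (hw' _ h)
  simp only [IsAcyclic, not_forall, not_not] at hnot
  obtain ⟨v, c, hcyc⟩ := hnot
  obtain ⟨l, hl, _⟩ := cyc_of_isCycle hcyc
  exact ⟨v, l, hl⟩

/-! ### The local rule and the off-cycle component -/

/-- `G` is triangle-free, and whenever `b₁ a₁ c a₂ b₂` is an induced path, each neighbour of its
centre `c` is adjacent to one of its ends. -/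
structure ClawTriFree (G : SimpleGraph V) : Prop where
  tri : ∀ {a b c : V}, G.Adj a b → G.Adj b c → ¬ G.Adj a c
  claw : ∀ {b₁ a₁ c a₂ b₂ d : V}, G.Adj b₁ a₁ → G.Adj a₁ c → G.Adj c a₂ → G.Adj a₂ b₂ →
    ¬ G.Adj b₁ a₂ → ¬ G.Adj a₁ b₂ → ¬ G.Adj b₁ b₂ → G.Adj c d → G.Adj d b₁ ∨ G.Adj d b₂

/-- `S` is the vertex set of a longest cycle, with `n + 1` vertices, of `G`,
chosen with as few edges off the cycle as possible, and `H` is the vertex set of a component of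
`G - S` that has an edge. -/
structure OffComponent (G : SimpleGraph V) (S H : Set V) (n : ℕ) : Prop extends ClawTriFree G where
  longest : ∀ {a l}, G.Cyc a l → l.length ≤ n
  exchange : ∀ {a l w x x'}, G.Cyc a l → l.length = n → w ∈ S → (∀ z ∉ S, ¬ G.Adj w z) →
    (∀ s ∈ S, s ≠ w → s ∈ a :: l) → x ∈ a :: l → x ∉ S → x' ∉ S → ¬ G.Adj x x'
  notMem : ∀ {x}, x ∈ H → x ∉ S
  closed : ∀ {x y}, x ∈ H → G.Adj x y → y ∉ S → y ∈ H
  link : ∀ {x y a b}, x ∈ H → y ∈ H → G.Adj a x → G.Adj y b →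
    ∃ l, G.Link a l b ∧ l.Nodup ∧ (∀ z ∈ l, z ∈ H) ∧ 1 ≤ l.length ∧ (x ∈ l) ∧
      (x ≠ y → 2 ≤ l.length)
  nbr : ∀ {x}, x ∈ H → ∃ x' ∈ H, G.Adj x x'
  cut : ∀ {u s} {T : Set V}, s ∈ T → s ≠ u →
    (∀ a ∈ T, a ≠ u → ∀ b, G.Adj a b → b ≠ u → b ∈ T) → ∀ w, w ≠ u → w ∈ T

/-- `a :: l` is a cyclic ordering of `S` along a cycle. -/
structure CycOn (G : SimpleGraph V) (S : Set V) (n : ℕ) (a : V) (l : List V) : Prop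
    extends Cyc G a l where
  mem : ∀ w, w ∈ a :: l ↔ w ∈ S
  length : l.length = n

variable {S H : Set V} {n : ℕ}

lemma CycOn.rotate {a b : V} {l m : List V} (h : G.CycOn S n a (l ++ b :: m)) :
    G.CycOn S n b (m ++ a :: l) := by
  refine ⟨h.toCyc.rotate, fun w => ?_, ?_⟩
  · rw [← h.mem w]
    simp only [List.mem_cons, List.mem_append]
    tauto
  · have := h.length
    simp only [List.length_append, List.length_cons] at this ⊢
    omega

lemma CycOn.reverse {a : V} {l : List V} (h : G.CycOn S n a l) :
    G.CycOn S n a l.reverse :=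
  ⟨h.toCyc.reverse, fun w => by rw [← h.mem w]; simp, by simpa using h.length⟩

/-! ### Detours through `H`: attachments are far apart -/

namespace OffComponent

/-- Two consecutive vertices of the cycle do not both have neighbours in `H`. -/
lemma not_adj_succ (h : G.OffComponent S H n) {u w : V} {t : List V} (hC : G.CycOn S n u (w :: t))
    {x y : V} (hx : x ∈ H) (hy : y ∈ H) (hux : G.Adj u x) : ¬ G.Adj w y := by
  intro hwy
  obtain ⟨l, h1, h2, h3, h4, -, -⟩ := h.link hx hy hux hwy.symm
  have hS : ∀ z ∈ l, z ∉ u :: w :: t := fun z hz => by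
    rw [hC.mem]
    exact h.notMem (h3 z hz)
  have := h.longest (a := u) (l := l ++ w :: t) ⟨?_, ?_, ?_⟩
  · have := hC.length
    simp at *
    omega
  · have := hC.link
    simp at this ⊢
    tauto
  · have := hC.nodup
    simp only [List.nodup_cons, List.nodup_append, List.mem_cons, List.mem_append] at *
    grind
  · have := hC.two_le
    simp at *
    omega

/-- The successors of two attachment vertices are not adjacent. -/
lemma not_adj_succ_succ (h : G.OffComponent S H n) {u u' v v' : V} {p q : List V}
    (hC : G.CycOn S n u (u' :: p ++ v :: v' :: q))
    {x y : V} (hx : x ∈ H) (hy : y ∈ H) (hux : G.Adj u x) (hvy : G.Adj v y) : ¬ G.Adj u' v' := by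
  intro hadj
  obtain ⟨l, h1, h2, h3, h4, -, -⟩ := h.link hx hy hux hvy.symm
  have hS : ∀ z ∈ l, z ∉ u :: (u' :: p ++ v :: v' :: q) := fun z hz => by
    rw [hC.mem]
    exact h.notMem (h3 z hz)
  have := h.longest (a := u) (l := l ++ v :: p.reverse ++ u' :: v' :: q) ⟨?_, ?_, ?_⟩
  · have := hC.length
    simp at *
    omega
  · have := hC.link
    simp at this ⊢
    have := this.2.1.reverse
    tauto
  · have := hC.nodup
    simp only [List.nodup_cons, List.nodup_append, List.mem_cons, List.mem_append,
      List.nodup_reverse, List.mem_reverse, List.cons_append] at *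
    grind
  · simp
    omega

lemma not_mem_of_adj (h : G.OffComponent S H n) {w z : V} (hz : z ∉ S) (hw : ∀ x ∈ H, ¬ G.Adj w x)
    (hwz : G.Adj w z) {x : V} (hx : x ∈ H) : ¬ G.Adj x z := fun hxz =>
  hw z (h.closed hx hxz hz) hwz

/-- Two vertices at distance two on the cycle do not both have neighbours in `H`. -/
lemma not_adj_succ_two (h : G.OffComponent S H n) {u w v : V} {t : List V}
    (hC : G.CycOn S n u (w :: v :: t)) {x y : V} (hx : x ∈ H) (hy : y ∈ H) (hux : G.Adj u x) :
    ¬ G.Adj v y := by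
  intro hvy
  have hne : t ≠ [] := by
    rintro rfl
    have := hC.link
    simp at this
    exact h.tri this.1 this.2.1 this.2.2.symm
  obtain ⟨v', t, rfl⟩ := List.exists_cons_of_ne_nil hne
  have hlen := hC.length
  have hnd := hC.nodup
  have hlk := hC.link
  -- If `x = y`, the detour swaps `w` for `x`, and `exchange` applies unless `w` has a neighbour `z`
  -- off the cycle. In that case the induced path `x' x v w z` gives `v' z`, and `u x v w z v'`
  -- lengthens the cycle. If `x ≠ y`, the detour is longer outright.
  by_cases hxy : x = y
  · subst hxy
    obtain ⟨x', hx', hxx'⟩ := h.nbr hx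
    have hxS : x ∉ u :: w :: v :: v' :: t := by rw [hC.mem]; exact h.notMem hx
    have hw : ∀ z ∈ H, ¬ G.Adj w z := fun z hz => h.not_adj_succ hC hx hz hux
    have hv' : ∀ z ∈ H, ¬ G.Adj v' z := fun z hz =>
      h.not_adj_succ (u := v) (w := v') (t := t ++ u :: [w]) (hC.rotate (l := [w])) hx hz hvy
    have hCx : G.Cyc u (x :: v :: v' :: t) := by
      refine ⟨?_, ?_, by simp⟩
      · simp at hlk ⊢
        exact ⟨hux, hvy.symm, hlk.2.2⟩
      · simp only [List.nodup_cons, List.mem_cons] at hnd hxS ⊢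
        grind
    refine h.exchange (w := w) (x := x) (x' := x') hCx (by simpa using hlen)
      ((hC.mem w).1 (by simp)) ?_ ?_ (by simp) (h.notMem hx) (h.notMem hx') hxx'
    · intro z hz hwz
      have hzS : z ∉ u :: w :: v :: v' :: t := by rwa [hC.mem]
      have hxz : ∀ y ∈ H, ¬ G.Adj y z := fun y hy => h.not_mem_of_adj hz hw hwz hy
      simp at hlk
      have hzv' : G.Adj v' z := by
        rcases h.claw hxx'.symm hvy.symm hlk.2.1.symm hwz (fun h' => hw _ hx' h'.symm) (hxz x hx)
          (hxz _ hx') hlk.2.2.1 with h' | h'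
        · exact absurd h' (hv' _ hx')
        · exact h'
      have := h.longest (a := u) (l := x :: v :: w :: z :: v' :: t) ⟨?_, ?_, by simp⟩
      · simp at this hlen
        omega
      · simp
        exact ⟨hux, hvy.symm, hlk.2.1.symm, hwz, hzv'.symm, hlk.2.2.2⟩
      · have hzx : z ≠ x := by
          rintro rfl
          exact hw _ hx hwz
        simp only [List.nodup_cons, List.mem_cons] at hnd hxS hzS ⊢
        grind
    · intro s hs hsw
      have := (hC.mem s).2 hs
      simp at this ⊢
      tauto
  · obtain ⟨l, h1, h2, h3, -, -, h4⟩ := h.link hx hy hux hvy.symm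
    have h4 := h4 hxy
    have hS : ∀ z ∈ l, z ∉ u :: w :: v :: v' :: t := fun z hz => by
      rw [hC.mem]
      exact h.notMem (h3 z hz)
    have := h.longest (a := u) (l := l ++ v :: v' :: t) ⟨?_, ?_, ?_⟩
    · simp at *
      omega
    · simp at hlk ⊢
      tauto
    · simp only [List.nodup_cons, List.nodup_append, List.mem_cons, List.mem_append] at *
      grind
    · simp
      omega

/-- The second successor of an attachment vertex `u` is adjacent to all neighbours of `u` that have
no neighbours in `H`. -/
lemma adj_succ_two (h : G.OffComponent S H n) {u w v d : V} {t : List V}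
    (hC : G.CycOn S n u (w :: v :: t)) {x : V} (hx : x ∈ H) (hux : G.Adj u x) (hud : G.Adj u d)
    (hd : ∀ y ∈ H, ¬ G.Adj d y) : G.Adj d v := by
  obtain ⟨x', hx', hxx'⟩ := h.nbr hx
  have hlk := hC.link
  simp at hlk
  have hw : ∀ z ∈ H, ¬ G.Adj w z := fun z hz => h.not_adj_succ hC hx hz hux
  have hv : ∀ z ∈ H, ¬ G.Adj v z := fun z hz => h.not_adj_succ_two hC hx hz hux
  -- The induced path is `x' x u w v`, with centre `u`.
  exact (h.claw hxx'.symm hux.symm hlk.1 hlk.2.1 (fun h' => hw _ hx' h'.symm)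
    (fun h' => hv _ hx h'.symm) (fun h' => hv _ hx' h'.symm) hud).resolve_left (hd _ hx')

end OffComponent

lemma CycOn.exists_of_mem {a : V} {l : List V} (hC : G.CycOn S n a l) {u : V} (hu : u ∈ S) :
    ∃ l', G.CycOn S n u l' := by
  rcases List.mem_cons.1 ((hC.mem u).2 hu) with rfl | h
  · exact ⟨l, hC⟩
  · obtain ⟨p, q, rfl⟩ := List.append_of_mem h
    exact ⟨_, hC.rotate⟩

lemma CycOn.exists_split {a : V} {l : List V} (hC : G.CycOn S n a l) {u v : V} (hu : u ∈ S)
    (hv : v ∈ S) (huv : u ≠ v) : ∃ p q, G.CycOn S n u (p ++ v :: q) := by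
  obtain ⟨l', h⟩ := hC.exists_of_mem hu
  obtain ⟨p, q, rfl⟩ := List.append_of_mem (List.mem_of_ne_of_mem huv.symm ((h.mem v).2 hv))
  exact ⟨p, q, h⟩

namespace OffComponent

lemma exists_cons_cons (h : G.OffComponent S H n) {u v : V} {p q : List V}
    (hC : G.CycOn S n u (p ++ v :: q)) {x y : V} (hx : x ∈ H) (hy : y ∈ H) (hux : G.Adj u x)
    (hvy : G.Adj v y) : ∃ a b p', p = a :: b :: p' := by
  match p, hC with
  | [], hC => exact absurd hvy (h.not_adj_succ hC hx hy hux)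
  | [w], hC => exact absurd hvy (h.not_adj_succ_two hC hx hy hux)
  | a :: b :: p', _ => exact ⟨a, b, p', rfl⟩

lemma exists_split (h : G.OffComponent S H n) {a₀ : V} {l : List V} (hC : G.CycOn S n a₀ l)
    {u v x y : V} (hu : u ∈ S) (hv : v ∈ S) (huv : u ≠ v) (hx : x ∈ H) (hy : y ∈ H)
    (hux : G.Adj u x) (hvy : G.Adj v y) :
    ∃ a b p c d q, G.CycOn S n u (a :: b :: p ++ v :: c :: d :: q) := by
  obtain ⟨p, q, hC⟩ := hC.exists_split hu hv huv
  obtain ⟨a, b, p, rfl⟩ := h.exists_cons_cons hC hx hy hux hvy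
  obtain ⟨c, d, q, rfl⟩ := h.exists_cons_cons hC.rotate hy hx hvy hux
  exact ⟨a, b, p, c, d, q, hC⟩

/-- If `b v` is not an edge, then neither is `b c`, for otherwise a detour missing only `a` gains
two vertices of `H` (`x ≠ y`, as there is no triangle). So `c v u a b` is an induced path centred at
`u`, and the neighbour `x` of `u` violates the rule. -/
lemma adj_succ_two_of_adj (h : G.OffComponent S H n) {u v a b c : V} {p q : List V}
    (hC : G.CycOn S n u (a :: b :: p ++ v :: c :: q)) {x y : V} (hx : x ∈ H) (hy : y ∈ H)
    (hux : G.Adj u x) (hvy : G.Adj v y) (huv : G.Adj u v) : G.Adj b v := by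
  have hxy : x ≠ y := by
    rintro rfl
    exact h.tri hux hvy.symm huv
  have hlk := hC.link
  have hnd := hC.nodup
  have hac : ¬ G.Adj a c := h.not_adj_succ_succ hC hx hy hux hvy
  have hCv : G.CycOn S n v (c :: q ++ u :: (a :: b :: p)) := hC.rotate
  have hc : ¬ G.Adj c x := h.not_adj_succ hCv hy hx hvy
  have hb : ¬ G.Adj b x := h.not_adj_succ_two hC hx hx hux
  simp at hlk
  by_contra hbv
  have hbc : ¬ G.Adj b c := by
    intro hbc
    obtain ⟨l, h1, h2, h3, -, -, h4⟩ := h.link hx hy hux hvy.symm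
    have h4 := h4 hxy
    have hS : ∀ z ∈ l, z ∉ u :: (a :: b :: p ++ v :: c :: q) := fun z hz => by
      rw [hC.mem]
      exact h.notMem (h3 z hz)
    have := h.longest (a := u) (l := l ++ v :: p.reverse ++ b :: c :: q) ⟨?_, ?_, ?_⟩
    · have := hC.length
      simp at *
      omega
    · have := hlk.2.2.1.reverse
      simp
      tauto
    · simp only [List.nodup_cons, List.nodup_append, List.mem_cons, List.mem_append,
        List.nodup_reverse, List.mem_reverse, List.cons_append] at *
      grind
    · simp
      omega
  rcases h.claw hlk.2.2.2.1.symm huv.symm hlk.1 hlk.2.1 (fun h' => hac h'.symm)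
    (fun h' => hbv h'.symm) (fun h' => hbc h'.symm) hux with h' | h'
  · exact hc h'.symm
  · exact hb h'.symm

/-- The previous lemma, seen from `v`, yields the edge `d u`. Then `x' x u d c` is induced with
centre `u`, so the successor `a` of `u` must be adjacent to `x'` or to `c`; both are excluded. -/
lemma not_adj_attach (h : G.OffComponent S H n) {a₀ : V} {l : List V} (hC : G.CycOn S n a₀ l)
    {u v x y : V} (hu : u ∈ S) (hv : v ∈ S) (hx : x ∈ H) (hy : y ∈ H)
    (hux : G.Adj u x) (hvy : G.Adj v y) : ¬ G.Adj u v := by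
  intro huv
  obtain ⟨a, b, p, c, d, q, hC⟩ := h.exists_split hC hu hv huv.ne hx hy hux hvy
  have hac : ¬ G.Adj a c := h.not_adj_succ_succ hC hx hy hux hvy
  have hCv : G.CycOn S n v (c :: d :: q ++ u :: a :: (b :: p)) := hC.rotate
  have hdu : G.Adj d u := h.adj_succ_two_of_adj hCv hy hx hvy hux huv.symm
  obtain ⟨x', hx', hxx'⟩ := h.nbr hx
  have hc : ∀ z ∈ H, ¬ G.Adj c z := fun z hz => h.not_adj_succ hCv hy hz hvy
  have hd : ∀ z ∈ H, ¬ G.Adj d z := fun z hz => h.not_adj_succ_two hCv hy hz hvy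
  have ha : ∀ z ∈ H, ¬ G.Adj a z := fun z hz => h.not_adj_succ hC hx hz hux
  have hlk := hC.link
  simp at hlk
  rcases h.claw hxx'.symm hux.symm hdu.symm hlk.2.2.2.2.1.symm (fun h' => hd _ hx' h'.symm)
    (fun h' => hc _ hx h'.symm) (fun h' => hc _ hx' h'.symm) hlk.1 with h' | h'
  · exact ha _ hx' h'
  · exact hac h'

/-- The rule at `u`, in both directions of the cycle, gives `c b` and `a m₂`; at `v`, with the path
`y' y v c b`, it gives `v' b`. Hence the cycle can run from `u` through `H` to `v`, back along `p`
to `b`, over to `v'`, on to `m₂`, and home through `a`, missing only `m₁`. -/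
lemma not_common_adj_attach (h : G.OffComponent S H n) {a₀ : V} {l : List V}
    (hC : G.CycOn S n a₀ l) {u v x y c : V} (hu : u ∈ S) (hv : v ∈ S) (huv : u ≠ v) (hx : x ∈ H)
    (hy : y ∈ H) (hux : G.Adj u x) (hvy : G.Adj v y) (hc : ∀ z ∈ H, ¬ G.Adj c z)
    (huc : G.Adj u c) : ¬ G.Adj v c := by
  intro hvc
  obtain ⟨p, q, hC⟩ := hC.exists_split hu hv huv
  obtain ⟨a, b, p, rfl⟩ := h.exists_cons_cons hC hx hy hux hvy
  have hCr : G.CycOn S n u (q.reverse ++ v :: (a :: b :: p).reverse) := by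
    have := hC.reverse
    simpa using this
  obtain ⟨m₁, m₂, r, hr⟩ := h.exists_cons_cons hCr hx hy hux hvy
  obtain rfl : q = r.reverse ++ [m₂, m₁] := by
    rw [← List.reverse_reverse q, hr]
    simp
  rw [hr] at hCr
  have hm₁ : ∀ z ∈ H, ¬ G.Adj m₁ z := fun z hz =>
    h.not_adj_succ (t := m₂ :: r ++ v :: (a :: b :: p).reverse) hCr hx hz hux
  have ha : ∀ z ∈ H, ¬ G.Adj a z := fun z hz => h.not_adj_succ hC hx hz hux
  have hb : ∀ z ∈ H, ¬ G.Adj b z := fun z hz => h.not_adj_succ_two hC hx hz hux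
  have hlk := hC.link
  have hnd := hC.nodup
  have hlen := hC.length
  have hcb : G.Adj c b := h.adj_succ_two hC hx hux huc hc
  have ham₂ : G.Adj a m₂ := by
    refine h.adj_succ_two (t := r ++ v :: (a :: b :: p).reverse) hCr hx hux ?_ ha
    simp at hlk
    exact hlk.1
  obtain ⟨v', t, hv'⟩ : ∃ v' t, r.reverse ++ [m₂] = v' :: t := by
    cases hr' : r.reverse ++ [m₂] with
    | nil => simp at hr'
    | cons v' t => exact ⟨v', t, rfl⟩
  have hq : r.reverse ++ [m₂, m₁] = v' :: (t ++ [m₁]) := by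
    rw [← List.cons_append, ← hv']
    simp
  have hbv : ¬ G.Adj b v := fun hbv => h.tri hcb hbv hvc.symm
  have hbv' : G.Adj v' b := by
    obtain ⟨y', hy', hyy'⟩ := h.nbr hy
    have hCv : G.CycOn S n v (v' :: (t ++ [m₁] ++ u :: (a :: b :: p))) := by
      have := hC.rotate
      rwa [hq] at this
    have hv'H : ∀ z ∈ H, ¬ G.Adj v' z := fun z hz => h.not_adj_succ hCv hy hz hvy
    have hlkv := hCv.link
    rw [link_cons] at hlkv
    exact (h.claw hyy'.symm hvy.symm hvc hcb (fun h' => hc _ hy' h'.symm)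
      (fun h' => hb _ hy h'.symm) (fun h' => hb _ hy' h'.symm) hlkv.1).resolve_left (hv'H _ hy')
  -- the detour through `H` that omits only `m₁`
  obtain ⟨l, h1, h2, h3, h5, h6, h4⟩ := h.link hx hy hux hvy.symm
  have hS : ∀ z ∈ l, z ∉ u :: (a :: b :: p ++ v :: (r.reverse ++ [m₂, m₁])) := fun z hz => by
    rw [hC.mem]
    exact h.notMem (h3 z hz)
  have hlk' : G.Link b p v ∧ G.Link v (r.reverse ++ [m₂]) m₁ ∧ G.Adj m₁ u ∧ G.Adj u a ∧
      G.Adj a b := by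
    simp at hlk ⊢
    tauto
  have hrt : G.Link b (r.reverse ++ [m₂]) m₁ ∧ G.Link b (r.reverse ++ [m₂]) a := by
    have := hlk'.2.1
    have h1 : G.Link b (r.reverse ++ [m₂]) m₁ := by
      rw [hv', link_cons] at this ⊢
      exact ⟨hbv'.symm, this.2⟩
    refine ⟨h1, ?_⟩
    rw [link_append_singleton] at h1 ⊢
    exact ⟨h1.1, ham₂.symm⟩
  have hpr := hlk'.1.reverse
  have hCyc : G.Cyc u (l ++ v :: p.reverse ++ b :: (r.reverse ++ [m₂]) ++ [a]) := by
    refine ⟨?_, ?_, ?_⟩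
    · have := hrt.2
      simp only [link_append_cons, List.append_assoc,
        List.cons_append] at this ⊢
      exact ⟨h1, hpr, this.1, this.2, link_nil.2 hlk'.2.2.2.1.symm⟩
    · clear * - hnd hS h2
      simp only [List.nodup_cons, List.nodup_append, List.mem_cons, List.mem_append,
        List.nodup_reverse, List.mem_reverse, List.cons_append, List.not_mem_nil] at hnd hS ⊢
      grind
    · simp
      omega
  -- For `x = y` the new cycle must have the old length, so `exchange` applies unless `m₁` has a
  -- neighbour `z` off the cycle; then the path `x' x u m₁ z` forces `a z`, and `m₁, z` fit between
  -- `m₂` and `a`.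
  by_cases hxy : x = y
  · subst hxy
    obtain ⟨x', hx', hxx'⟩ := h.nbr hx
    have hlenl : l.length = 1 := by
      have := h.longest hCyc
      simp at this hlen
      omega
    refine h.exchange (w := m₁) (x := x) (x' := x') hCyc ?_ ((hC.mem m₁).1 (by simp)) ?_ ?_
      (by simp [h6]) (h.notMem hx) (h.notMem hx') hxx'
    · simp at hlen ⊢
      omega
    · intro z hz hm₁z
      have hzS : z ∉ u :: (a :: b :: p ++ v :: (r.reverse ++ [m₂, m₁])) := by rwa [hC.mem]
      have hxz : ∀ y ∈ H, ¬ G.Adj y z := fun y hy => h.not_mem_of_adj hz hm₁ hm₁z hy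
      have haz : G.Adj a z := (h.claw hxx'.symm hux.symm hlk'.2.2.1.symm hm₁z
        (fun h' => hm₁ _ hx' h'.symm) (hxz x hx) (hxz _ hx') hlk'.2.2.2.1).resolve_left
          (ha _ hx')
      have hzl : z ∉ l := fun hzl => hm₁ _ (h3 z hzl) hm₁z
      have := h.longest (a := u)
        (l := l ++ v :: p.reverse ++ b :: (r.reverse ++ [m₂]) ++ [m₁, z, a]) ⟨?_, ?_, ?_⟩
      · simp at this hlen
        omega
      · have := hrt.1
        simp only [link_append_cons, link_cons, List.append_assoc,
          List.cons_append, link_nil] at this ⊢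
        exact ⟨h1, hpr, this.1, this.2, hm₁z, haz.symm, hlk'.2.2.2.1.symm⟩
      · clear * - hnd hS h2 hzl hzS
        simp only [List.nodup_cons, List.nodup_append, List.mem_cons, List.mem_append,
          List.nodup_reverse, List.mem_reverse, List.cons_append, List.not_mem_nil] at hnd hS hzS ⊢
        grind
      · simp
        omega
    · intro s hs hsw
      have := (hC.mem s).2 hs
      simp at this ⊢
      tauto
  · have h4 := h4 hxy
    have := h.longest hCyc
    simp at this hlen
    omega

end OffComponent

/-! ### Chains of independent sets and absorption -/

/-- A labelling of `S` by `0, …, k` that exhibits the graph on `S` as a chain of independent sets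
running from `u` to `v`, consecutive inner ones of which are completely joined. -/
structure ChainLabelling (G : SimpleGraph V) (S : Set V) (u v : V) (k : ℕ) (f : V → ℕ) : Prop where
  step : ∀ {a b}, a ∈ S → b ∈ S → G.Adj a b → f a = f b + 1 ∨ f b = f a + 1
  left : f u = 0
  right : f v = k
  mid : ∀ {a}, a ∈ S → a ≠ u → a ≠ v → 1 ≤ f a ∧ f a + 1 ≤ k
  complete : ∀ {a b}, a ∈ S → b ∈ S → 1 ≤ f a → f b = f a + 1 → f b + 1 ≤ k → G.Adj a b

namespace ChainLabelling

variable {u v : V} {k : ℕ} {f : V → ℕ}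

/-- Labels change by one along an edge, so the walk to `v` must step up from level `f q` to level `f
q + 1`. Between those two vertices `q', q` can be inserted, since both levels are inner and
completely joined. -/
lemma exists_insert (hf : G.ChainLabelling S u v k f) (hv : v ∈ S) {q q' : V} (hq : q ∈ S)
    (hq' : q' ∈ S) (h1 : 1 ≤ f q) (h2 : f q' = f q + 1) (h3 : f q' + 1 ≤ k) {a : V} {l : List V}
    (ha : a ∈ S) (hl : ∀ z ∈ l, z ∈ S) (hal : G.Link a l v) (hfa : f a ≤ f q) :
    ∃ l', G.Link a l' v ∧ l'.Perm (q :: q' :: l) := by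
  induction l generalizing a with
  | nil =>
    have := hf.step ha hv (link_nil.1 hal)
    have := hf.right
    omega
  | cons c l ih =>
    obtain ⟨hac, hcl⟩ := link_cons.1 hal
    have hc : c ∈ S := hl c (by simp)
    rcases Nat.lt_or_ge (f q) (f c) with hlt | hle
    · have hfac := hf.step ha hc hac
      refine ⟨q' :: q :: c :: l, ?_, List.Perm.swap _ _ _⟩
      simp only [link_cons]
      exact ⟨hf.complete ha hq' (by omega) (by omega) h3, (hf.complete hq hq' h1 h2 h3).symm,
        hf.complete hq hc h1 (by omega) (by omega), hcl⟩
    · obtain ⟨l', h4, h5⟩ := ih hc (fun z hz => hl z (by simp [hz])) hcl hle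
      refine ⟨c :: l', link_cons.2 ⟨hac, h4⟩, ?_⟩
      refine (h5.cons c).trans ?_
      exact (List.Perm.swap _ _ _).trans ((List.Perm.swap _ _ _).cons _)

/-- Consecutive vertices of `m` lie on adjacent inner levels, so `m` is absorbed in pairs; the `+ 1`
accounts for a last unpaired vertex. -/
lemma exists_absorb (hf : G.ChainLabelling S u v k f) (hu : u ∈ S) (hv : v ∈ S) :
    ∀ (m l : List V), m.IsChain G.Adj → (∀ z ∈ m, z ∈ S ∧ z ≠ u ∧ z ≠ v) → (∀ z ∈ l, z ∈ S) →
      G.Link u l v → ∃ l', G.Link u l' v ∧ l'.Subperm (m ++ l) ∧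
        m.length + l.length ≤ l'.length + 1
  | [], l, _, _, _, h => ⟨l, h, List.Subperm.refl _, by simp⟩
  | [q], l, _, _, _, h =>
    ⟨l, h, (List.sublist_append_right [q] l).subperm, by simp; omega⟩
  | q :: q' :: m, l, hm, hmS, hlS, h => by
    obtain ⟨hqS, hqu, hqv⟩ := hmS q (by simp)
    obtain ⟨hqS', hqu', hqv'⟩ := hmS q' (by simp)
    rw [List.isChain_cons_cons] at hm
    have hq := hf.mid hqS hqu hqv
    have hq' := hf.mid hqS' hqu' hqv'
    have hleft := hf.left
    obtain ⟨l₁, h1, h2⟩ : ∃ l₁, G.Link u l₁ v ∧ l₁.Perm (q :: q' :: l) := by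
      rcases hf.step hqS hqS' hm.1 with h' | h'
      · obtain ⟨l₁, h1, h2⟩ := hf.exists_insert hv hqS' hqS hq'.1 h' hq.2 hu hlS h (by omega)
        exact ⟨l₁, h1, h2.trans (List.Perm.swap _ _ _)⟩
      · exact hf.exists_insert hv hqS hqS' hq.1 h' hq'.2 hu hlS h (by omega)
    obtain ⟨l', h3, h4, h5⟩ := hf.exists_absorb hu hv m l₁ hm.2.tail
      (fun z hz => hmS z (by simp [hz])) (fun z hz => by
        have := h2.mem_iff.1 hz
        simp only [List.mem_cons] at this
        rcases this with rfl | rfl | h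
        · exact hqS
        · exact hqS'
        · exact hlS z h) h1
    refine ⟨l', h3, h4.trans (List.Perm.subperm ?_), ?_⟩
    · refine (h2.append_left m).trans ?_
      have : (m ++ q :: q' :: l).Perm (q :: (m ++ q' :: l)) := List.perm_middle
      exact this.trans (List.perm_middle.cons q)
    · have := h2.length_eq
      simp at this ⊢
      omega

end ChainLabelling

lemma Link.isChain_interior {a b : V} {l : List V} (h : G.Link a l b) : l.IsChain G.Adj := by
  have : (l ++ [b]).IsChain G.Adj := List.IsChain.tail h
  exact this.left_of_append

/-! ### A chain labelling yields a longer cycle -/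

namespace OffComponent

lemma mem_of_adj (h : G.OffComponent S H n) {u x : V} (hx : x ∈ H) (hux : G.Adj u x) (hu : u ∉ H) :
    u ∈ S := by
  by_contra hS
  exact hu (h.closed hx hux.symm hS)

/-- Otherwise `s` would separate `H` from `t`. -/
lemma exists_attach_ne (h : G.OffComponent S H n) {x₀ : V} (hx₀ : x₀ ∈ H) {s t : V} (hs : s ∈ S)
    (ht : t ∈ S) (hst : t ≠ s) : ∃ u ∈ S, u ≠ s ∧ ∃ x ∈ H, G.Adj u x := by
  by_contra! hcon
  refine h.notMem (h.cut (u := s) hx₀ (fun hh => h.notMem hx₀ (hh ▸ hs)) ?_ t hst) ht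
  intro a ha _ b hab hb
  by_contra hbH
  exact hcon b (h.mem_of_adj ha hab.symm hbH) hb a ha hab.symm

lemma exists_two_attach (h : G.OffComponent S H n) {a₀ : V} {l : List V} (hC : G.CycOn S n a₀ l)
    {x₀ : V} (hx₀ : x₀ ∈ H) :
    ∃ u v, u ∈ S ∧ v ∈ S ∧ u ≠ v ∧ (∃ x ∈ H, G.Adj u x) ∧ ∃ y ∈ H, G.Adj v y := by
  have h2 := hC.two_le
  obtain ⟨b, m, rfl⟩ : ∃ b m, l = b :: m := by
    cases l with
    | nil => simp at h2
    | cons b m => exact ⟨b, m, rfl⟩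
  have ha := (hC.mem a₀).1 (by simp)
  have hb := (hC.mem b).1 (by simp)
  have hnd := hC.nodup
  simp only [List.nodup_cons, List.mem_cons] at hnd
  obtain ⟨u, hu, -, hux⟩ := h.exists_attach_ne hx₀ ha hb (fun hh => hnd.1 (.inl hh.symm))
  by_cases hua : u = a₀
  · obtain ⟨v, hv, hvu, hvy⟩ := h.exists_attach_ne hx₀ hu hb
      (fun hh => hnd.1 (.inl (hua ▸ hh.symm)))
    exact ⟨u, v, hu, hv, hvu.symm, hux, hvy⟩
  · obtain ⟨v, hv, hvu, hvy⟩ := h.exists_attach_ne hx₀ hu ha (fun hh => hua hh.symm)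
    exact ⟨u, v, hu, hv, hvu.symm, hux, hvy⟩

/-- Otherwise `u` and `v` share a single contact in `H`; as no other vertex of `S` attaches,
deleting that contact would cut the rest of `H` off from `u`. -/
lemma exists_distinct_contacts (h : G.OffComponent S H n) {u v x₀ y₀ : V} (hu : u ∈ S)
    (hx₀ : x₀ ∈ H) (hy₀ : y₀ ∈ H) (hux₀ : G.Adj u x₀) (hvy₀ : G.Adj v y₀)
    (hU : ∀ w ∈ S, ∀ z ∈ H, G.Adj w z → w = u ∨ w = v) :
    ∃ x ∈ H, ∃ y ∈ H, x ≠ y ∧ G.Adj u x ∧ G.Adj v y := by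
  by_contra! hcon
  have hxy : ∀ x ∈ H, ∀ y ∈ H, G.Adj u x → G.Adj v y → x = y := fun x hx y hy h1 h2 => by
    by_contra hne
    exact hcon x hx y hy hne h1 h2
  obtain ⟨x', hx', hxx'⟩ := h.nbr hx₀
  have hne : u ≠ x₀ := fun hh => h.notMem hx₀ (hh ▸ hu)
  refine h.notMem (h.cut (u := x₀) hx' hxx'.ne' ?_ u hne) hu
  intro a ha hax b hab hb
  by_contra hbH
  have hbS := h.mem_of_adj ha hab.symm hbH
  rcases hU b hbS a ha hab.symm with rfl | rfl
  · exact hax ((hxy a ha y₀ hy₀ hab.symm hvy₀).trans (hxy x₀ hx₀ y₀ hy₀ hux₀ hvy₀).symm)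
  · exact hax (hxy x₀ hx₀ a ha hux₀ hab.symm).symm

/-- Absorbing the arc `q` into `p` loses at most one vertex, while the return path through `H` gains
at least two. -/
lemma not_chainLabelling (h : G.OffComponent S H n) {a₀ : V} {l : List V} (hC : G.CycOn S n a₀ l)
    {u v x₀ y₀ : V} (hu : u ∈ S) (hv : v ∈ S) (huv : u ≠ v)
    (hx₀ : x₀ ∈ H) (hy₀ : y₀ ∈ H) (hux₀ : G.Adj u x₀) (hvy₀ : G.Adj v y₀)
    (hU : ∀ w ∈ S, ∀ z ∈ H, G.Adj w z → w = u ∨ w = v) {k : ℕ} {f : V → ℕ} :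
    ¬ G.ChainLabelling S u v k f := by
  intro hf
  obtain ⟨x, hx, y, hy, hxy, hux, hvy⟩ := h.exists_distinct_contacts hu hx₀ hy₀ hux₀ hvy₀ hU
  obtain ⟨p, q, hC⟩ := hC.exists_split hu hv huv
  obtain ⟨r, h1, h2, h3, -, -, h4⟩ := h.link hy hx hvy hux.symm
  have h4 := h4 hxy.symm
  have hlk := hC.link
  rw [link_append_cons] at hlk
  have hnd := hC.nodup
  have hmem : ∀ z, z ∈ p ∨ z ∈ q → z ∈ S := fun z hz => by
    rw [← hC.mem]
    simp only [List.mem_cons, List.mem_append]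
    tauto
  obtain ⟨l', h5, h6, h7⟩ := hf.exists_absorb hu hv q p hlk.2.isChain_interior
    (fun z hz => ⟨hmem z (.inr hz), by grind, by grind⟩) (fun z hz => hmem z (.inl hz)) hlk.1
  have hl' : ∀ z ∈ l', z ∈ q ∨ z ∈ p := fun z hz => by simpa using h6.subset hz
  have hl'n : l'.Nodup := by
    obtain ⟨w, hw, hw'⟩ := h6
    refine hw.nodup (hw'.nodup ?_)
    clear * - hnd
    simp only [List.nodup_cons, List.nodup_append, List.mem_cons, List.mem_append] at hnd ⊢
    grind
  have hr : ∀ z ∈ r, z ∉ u :: (p ++ v :: q) := fun z hz => by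
    rw [hC.mem]
    exact h.notMem (h3 z hz)
  have := h.longest (a := u) (l := l' ++ v :: r) ⟨?_, ?_, ?_⟩
  · have := hC.length
    simp at this
    simp at *
    omega
  · simp
    exact ⟨h5, h1⟩
  · clear * - hnd hl' hl'n hr h2
    simp only [List.nodup_cons, List.nodup_append, List.mem_cons, List.mem_append] at hnd hr ⊢
    grind
  · simp
    omega

end OffComponent

lemma Link.forall_mem {a b : V} {l : List V} (h : G.Link a l b) {P Q : V → Prop}
    (hP : ∀ x y, P x → G.Adj x y → Q y → P y) (ha : P a) (hQ : ∀ z ∈ l, Q z) : ∀ z ∈ l, P z := by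
  induction l generalizing a with
  | nil => simp
  | cons c l ih =>
    obtain ⟨h1, h2⟩ := link_cons.1 h
    have hc : P c := hP a c ha h1 (hQ c (by simp))
    intro z hz
    rcases List.mem_cons.1 hz with rfl | hz
    · exact hc
    · exact ih h2 hc (fun z hz => hQ z (by simp [hz])) z hz

/-- The cycle makes `S` connected, so a property that spreads along edges inside `S` holds on all of
it. -/
lemma CycOn.forall_mem {a₀ : V} {l : List V} (hC : G.CycOn S n a₀ l) {P : V → Prop} {u : V}
    (hu : u ∈ S) (hPu : P u) (hP : ∀ x y, P x → G.Adj x y → y ∈ S → P y) : ∀ s ∈ S, P s := by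
  obtain ⟨l', hC⟩ := hC.exists_of_mem hu
  intro s hs
  rcases List.mem_cons.1 ((hC.mem s).2 hs) with rfl | hs'
  · exact hPu
  · exact hC.link.forall_mem hP hPu (fun z hz => (hC.mem z).1 (List.mem_cons_of_mem _ hz)) s hs'

/-! ### Attachments at distance three -/

/-- `u ∉ H` has a neighbour in `H`. -/
def Attach (G : SimpleGraph V) (H : Set V) (u : V) : Prop :=
  u ∉ H ∧ ∃ x ∈ H, G.Adj u x

/-- Vertices outside `H` at distance one or two, outside `H`, from a vertex with neighbours in `H`
have no neighbours in `H` themselves. -/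
structure SparseAttach (G : SimpleGraph V) (H : Set V) : Prop extends ClawTriFree G where
  nbr : ∀ {x}, x ∈ H → ∃ x' ∈ H, G.Adj x x'
  not_adj : ∀ {u v}, G.Attach H u → G.Attach H v → ¬ G.Adj u v
  not_common : ∀ {u v c}, G.Attach H u → G.Attach H v → u ≠ v → c ∉ H → G.Adj u c → ¬ G.Adj v c

lemma OffComponent.mem_of_attach (h : G.OffComponent S H n) {u : V} (hu : G.Attach H u) :
    u ∈ S := by
  obtain ⟨hu, x, hx, hux⟩ := hu
  exact h.mem_of_adj hx hux hu

lemma OffComponent.sparseAttach (h : G.OffComponent S H n) {a₀ : V} {l : List V}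
    (hC : G.CycOn S n a₀ l) : G.SparseAttach H where
  toClawTriFree := h.toClawTriFree
  nbr := h.nbr
  not_adj := by
    intro u v hu hv
    obtain ⟨-, x, hx, hux⟩ := id hu
    obtain ⟨-, y, hy, hvy⟩ := id hv
    exact h.not_adj_attach hC (h.mem_of_attach hu) (h.mem_of_attach hv) hx hy hux hvy
  not_common := by
    intro u v c hu hv huv hc huc
    obtain ⟨-, x, hx, hux⟩ := id hu
    obtain ⟨-, y, hy, hvy⟩ := id hv
    refine h.not_common_adj_attach hC (h.mem_of_attach hu) (h.mem_of_attach hv) huv hx hy hux hvy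
      (fun z hz hcz => ?_) huc
    exact h.not_adj_attach hC (h.mem_of_attach hu) (h.mem_of_adj hz hcz hc) hx hz hux hcz huc

namespace SparseAttach

variable {u v l l' w z t l₁ m₁ x : V}

lemma not_adj_of_adj (h : G.SparseAttach H) (hu : G.Attach H u) (hl : l ∉ H) (hul : G.Adj u l)
    (hz : z ∈ H) : ¬ G.Adj l z := fun hlz => h.not_adj hu ⟨hl, z, hz, hlz⟩ hul

lemma not_adj_of_adj_adj (h : G.SparseAttach H) (hu : G.Attach H u) (hl : l ∉ H) (hul : G.Adj u l)
    (hw : w ∉ H) (hlw : G.Adj l w) (hwu : w ≠ u) (hz : z ∈ H) : ¬ G.Adj w z := fun hwz =>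
  h.not_common hu ⟨hw, z, hz, hwz⟩ hwu.symm hl hul hlw.symm

/-- The rule for `x' x u l w`, with centre `u`. It makes all neighbours of `u` outside `H` have the
same neighbours there. -/
lemma adj_of_adj_adj (h : G.SparseAttach H) (hu : G.Attach H u) (hl : l ∉ H) (hl' : l' ∉ H)
    (hul : G.Adj u l) (hul' : G.Adj u l') (hw : w ∉ H) (hlw : G.Adj l w) (hwu : w ≠ u) :
    G.Adj l' w := by
  obtain ⟨x, hx, hux⟩ := hu.2
  obtain ⟨x', hx', hxx'⟩ := h.nbr hx
  exact (h.claw hxx'.symm hux.symm hul hlw (fun h' => h.not_adj_of_adj hu hl hul hx' h'.symm)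
    (fun h' => h.not_adj_of_adj_adj hu hl hul hw hlw hwu hx h'.symm)
    (fun h' => h.not_adj_of_adj_adj hu hl hul hw hlw hwu hx' h'.symm) hul').resolve_left
      (h.not_adj_of_adj hu hl' hul' hx')

/-- The vertices outside `H` that are reached from `u` in two steps outside `H`. -/
def TwoStep (G : SimpleGraph V) (H : Set V) (u w : V) : Prop :=
  w ∉ H ∧ w ≠ u ∧ ∃ l ∉ H, G.Adj u l ∧ G.Adj l w

lemma TwoStep.not_adj (h : G.SparseAttach H) (hu : G.Attach H u) (hw : TwoStep G H u w)
    (hz : z ∈ H) : ¬ G.Adj w z := by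
  obtain ⟨hwH, hwu, l, hl, hul, hlw⟩ := hw
  exact h.not_adj_of_adj_adj hu hl hul hwH hlw hwu hz

/-- `u l₁ m₁ v` is a path outside `H` between two vertices with neighbours in `H`. -/
structure ThreePath (G : SimpleGraph V) (H : Set V) (u l₁ m₁ v : V) : Prop where
  left : G.Attach H u
  right : G.Attach H v
  ne : u ≠ v
  notMem_left : l₁ ∉ H
  notMem_right : m₁ ∉ H
  adj_left : G.Adj u l₁
  adj_mid : G.Adj l₁ m₁
  adj_right : G.Adj m₁ v

lemma ThreePath.symm (p : ThreePath G H u l₁ m₁ v) : ThreePath G H v m₁ l₁ u :=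
  ⟨p.right, p.left, p.ne.symm, p.notMem_right, p.notMem_left, p.adj_right.symm, p.adj_mid.symm,
    p.adj_left.symm⟩

lemma ThreePath.twoStep_left (h : G.SparseAttach H) (p : ThreePath G H u l₁ m₁ v) :
    TwoStep G H u m₁ :=
  ⟨p.notMem_right, fun hh => h.not_adj p.left p.right (hh ▸ p.adj_right), l₁, p.notMem_left,
    p.adj_left, p.adj_mid⟩

lemma ThreePath.adj_of_twoStep (h : G.SparseAttach H) (p : ThreePath G H u l₁ m₁ v)
    (hw : TwoStep G H u w) : G.Adj l₁ w := by
  obtain ⟨hwH, hwu, l, hl, hul, hlw⟩ := hw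
  exact h.adj_of_adj_adj p.left hl p.notMem_left hul p.adj_left hwH hlw hwu

lemma ThreePath.twoStep_of_adj (h : G.SparseAttach H) (p : ThreePath G H u l₁ m₁ v)
    (hl : l ∉ H) (hul : G.Adj u l) : TwoStep G H v l := by
  refine ⟨hl, fun hh => h.not_adj p.left p.right (hh ▸ hul), m₁, p.notMem_right, p.adj_right.symm,
    ?_⟩
  exact (h.adj_of_adj_adj p.left p.notMem_left hl p.adj_left hul p.notMem_right p.adj_mid
    (p.twoStep_left h).2.1).symm

/-- If `u z` is not an edge, then `x u l₁ m₁ z` is an induced path with centre `l₁`, a neighbour of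
`w`; and `w` has no neighbour in `H`. -/
lemma ThreePath.adj_twoStep (h : G.SparseAttach H) (p : ThreePath G H u l₁ m₁ v)
    (hz : TwoStep G H v z) (hw : TwoStep G H u w) : G.Adj z w := by
  by_cases huz : G.Adj u z
  · obtain ⟨hwH, hwu, l, hl, hul, hlw⟩ := hw
    exact h.adj_of_adj_adj p.left hl hz.1 hul huz hwH hlw hwu
  · obtain ⟨x, hx, hux⟩ := p.left.2
    have hwx : ¬ G.Adj w x := hw.not_adj h p.left hx
    have hzx : ¬ G.Adj z x := hz.not_adj h p.right hx
    have hmx : ¬ G.Adj m₁ x := h.not_adj_of_adj p.right p.notMem_right p.adj_right.symm hx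
    exact ((h.claw hux.symm p.adj_left p.adj_mid (p.symm.adj_of_twoStep h hz)
      (fun h' => hmx h'.symm) huz (fun h' => hzx h'.symm)
      (p.adj_of_twoStep h hw)).resolve_left hwx).symm

/-- Suppose `t ≠ v` is not adjacent to `u`. If `t` attaches, the path `t w l₁ m₁ v` and the
neighbour `u` of its centre break the rule. If not, the path `x u l₁ w t` forces `m₁ t`. -/
lemma ThreePath.of_adj_twoStep (h : G.SparseAttach H) (p : ThreePath G H u l₁ m₁ v)
    (ht : t ∉ H) (hw : TwoStep G H u w) (hwt : G.Adj w t) : t = v ∨ TwoStep G H v t := by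
  by_cases hut : G.Adj u t
  · exact .inr (p.twoStep_of_adj h ht hut)
  by_cases htv : t = v
  · exact .inl htv
  have hlw := p.adj_of_twoStep h hw
  by_cases hta : G.Attach H t
  · have hn₁ : ¬ G.Adj t m₁ := fun h' =>
      h.not_common hta p.right htv p.notMem_right h' p.adj_right.symm
    have hn₂ : ¬ G.Adj w v := fun h' => h.not_common hta p.right htv hw.1 hwt.symm h'.symm
    rcases h.claw hwt.symm hlw.symm p.adj_mid p.adj_right hn₁ hn₂ (h.not_adj hta p.right)
      p.adj_left.symm with h' | h'
    · exact absurd h' hut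
    · exact absurd h' (h.not_adj p.left p.right)
  · obtain ⟨x, hx, hux⟩ := p.left.2
    have htx : ¬ G.Adj t x := fun h' => hta ⟨ht, x, hx, h'⟩
    have hwx : ¬ G.Adj w x := hw.not_adj h p.left hx
    have hmx : ¬ G.Adj m₁ x := h.not_adj_of_adj p.right p.notMem_right p.adj_right.symm hx
    have := (h.claw hux.symm p.adj_left hlw hwt (fun h' => hwx h'.symm) hut
      (fun h' => htx h'.symm) p.adj_mid).resolve_left hmx
    exact .inr ⟨ht, htv, m₁, p.notMem_right, p.adj_right.symm, this⟩

lemma ThreePath.exists_chainLabelling (h : G.SparseAttach H) (p : ThreePath G H u l₁ m₁ v)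
    (hSH : ∀ s ∈ S, s ∉ H) {a₀ : V} {l : List V} (hC : G.CycOn S n a₀ l) (hu : u ∈ S) :
    (∃ f, G.ChainLabelling S u v 3 f) ∧ ∀ w ∈ S, ∀ z ∈ H, G.Adj w z → w = u ∨ w = v := by
  classical
  have hall : ∀ s ∈ S, s = u ∨ s = v ∨ TwoStep G H v s ∨ TwoStep G H u s := by
    refine hC.forall_mem hu (.inl rfl) ?_
    rintro x y (rfl | rfl | hx | hx) hxy hy
    · exact .inr (.inr (.inl (p.twoStep_of_adj h (hSH y hy) hxy)))
    · exact .inr (.inr (.inr (p.symm.twoStep_of_adj h (hSH y hy) hxy)))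
    · have := p.symm.of_adj_twoStep h (hSH y hy) hx hxy
      tauto
    · have := p.of_adj_twoStep h (hSH y hy) hx hxy
      tauto
  have huA : ∀ {z}, TwoStep G H v z → z ≠ u := by
    rintro z hz rfl
    obtain ⟨x, hx, hux⟩ := p.left.2
    exact hz.not_adj h p.right hx hux
  have hvB : ∀ {w}, TwoStep G H u w → w ≠ v := by
    rintro w hw rfl
    obtain ⟨x, hx, hux⟩ := p.right.2
    exact hw.not_adj h p.left hx hux
  have hAB : ∀ {z}, TwoStep G H v z → ¬ TwoStep G H u z := fun hz hz' =>
    (p.adj_twoStep h hz hz').ne rfl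
  -- The levels are `{u}`, the vertices two steps from `v`, those two steps from `u`, and `{v}`. The
  -- middle two are disjoint because they are completely joined and `G` has no loops.
  refine ⟨⟨fun s => if s = u then 0 else if s = v then 3 else if TwoStep G H v s then 1 else 2,
    ⟨?_, by simp, by simp [p.ne.symm], ?_, ?_⟩⟩, ?_⟩
  · intro a b ha hb hab
    have hbH := hSH b hb
    have hnuv := p.ne
    rcases hall a ha with rfl | rfl | hA | hB
    · have hb' := p.twoStep_of_adj h hbH hab
      simp [huA hb', hb'.2.1, hb']
    · have hb' := p.symm.twoStep_of_adj h hbH hab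
      have : ¬ TwoStep G H a b := fun hh => hAB hh hb'
      simp [hvB hb', hb'.2.1, this, hnuv.symm]
    · rcases p.symm.of_adj_twoStep h hbH hA hab with rfl | hb'
      · simp [huA hA, hA.2.1, hA]
      · have : ¬ TwoStep G H v b := fun hh => hAB hh hb'
        simp [huA hA, hA.2.1, hA, hvB hb', hb'.2.1, this]
    · have hA' : ¬ TwoStep G H v a := fun hh => hAB hh hB
      rcases p.of_adj_twoStep h hbH hB hab with rfl | hb'
      · simp [hvB hB, hB.2.1, hA', hnuv.symm]
      · simp [huA hb', hb'.2.1, hb', hvB hB, hB.2.1, hA']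
  · intro a _ hau hav
    simp only [hau, hav, if_false]
    split_ifs <;> omega
  · intro a b ha hb
    rcases hall a ha with rfl | rfl | hA | hB
    · simp
    · simp [p.ne.symm]
      intros
      omega
    · rcases hall b hb with rfl | rfl | hA' | hB'
      · simp
      · simp [p.ne.symm, huA hA, hA.2.1, hA]
      · simp [huA hA, hA.2.1, hA, huA hA', hA'.2.1, hA']
      · intros
        exact p.adj_twoStep h hA hB'
    · have hA' : ¬ TwoStep G H v a := fun hh => hAB hh hB
      simp only [hvB hB, hB.2.1, hA', if_false]
      intros
      omega
  · intro w hw z hz hwz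
    rcases hall w hw with hh | hh | hA | hB
    · exact .inl hh
    · exact .inr hh
    · exact absurd hwz (hA.not_adj h p.right hz)
    · exact absurd hwz (hB.not_adj h p.left hz)

end SparseAttach

/-! ### Distance layers outside `H` -/

/-- The graph `G` without the edges that meet `H`. -/
def avoiding (G : SimpleGraph V) (H : Set V) : SimpleGraph V where
  Adj a b := G.Adj a b ∧ a ∉ H ∧ b ∉ H
  symm := ⟨fun _ _ h => ⟨h.1.symm, h.2.2, h.2.1⟩⟩
  loopless := ⟨fun _ h => h.1.ne rfl⟩

/-- `G.Layer H u i w`: the vertex `w` is at distance `i` from `u` outside `H`. -/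
def Layer (G : SimpleGraph V) (H : Set V) (u : V) (i : ℕ) (w : V) : Prop :=
  (G.avoiding H).edist u w = i

namespace Layer

variable {u v w a b : V} {i j k : ℕ}

lemma zero_iff : G.Layer H u 0 w ↔ w = u := by
  rw [Layer, Nat.cast_zero, edist_eq_zero_iff, eq_comm]

lemma unique (h : G.Layer H u i w) (h' : G.Layer H u j w) : i = j := by
  unfold Layer at h h'
  rw [h] at h'
  exact_mod_cast h'

lemma le_add (h : G.Layer H u k v) (h₁ : G.Layer H u i w) (h₂ : G.Layer H v j w) :
    k ≤ i + j := by
  have := (G.avoiding H).edist_triangle (u := u) (v := w) (w := v)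
  rw [edist_comm (u := w)] at this
  unfold Layer at h h₁ h₂
  rw [h, h₁, h₂] at this
  exact_mod_cast this

lemma exists_of_adj (h : G.Layer H u i a) (hab : (G.avoiding H).Adj a b) :
    ∃ j, G.Layer H u j b ∧ j ≤ i + 1 ∧ i ≤ j + 1 := by
  have h1 : (G.avoiding H).edist a b = 1 := edist_eq_one_iff_adj.2 hab
  have h2 := (G.avoiding H).edist_triangle (u := u) (v := a) (w := b)
  have h3 := (G.avoiding H).edist_triangle (u := u) (v := b) (w := a)
  unfold Layer at h
  rw [h, h1] at h2
  rw [h, edist_comm (u := b), h1] at h3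
  obtain ⟨j, hj⟩ := ENat.ne_top_iff_exists.1 (ne_top_of_le_ne_top (by simp) h2)
  refine ⟨j, hj.symm, ?_, ?_⟩
  · rw [← hj] at h2
    exact_mod_cast h2
  · rw [← hj] at h3
    exact_mod_cast h3

lemma exists_pred (h : G.Layer H u (i + 1) w) :
    ∃ a, (G.avoiding H).Adj a w ∧ G.Layer H u i a := by
  obtain ⟨p, hp⟩ := exists_walk_of_edist_eq_coe h
  have hp' : p.reverse.length = i + 1 := by simpa using hp
  cases hq : p.reverse with
  | nil => simp [hq] at hp'
  | cons hadj q =>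
    rename_i a
    rw [hq] at hp'
    simp only [Walk.length_cons, Nat.add_right_cancel_iff] at hp'
    refine ⟨a, hadj.symm, ?_⟩
    have h1 : (G.avoiding H).edist u a ≤ i := by
      have := edist_le q.reverse
      simpa [hp'] using this
    obtain ⟨j, hj⟩ := ENat.ne_top_iff_exists.1 (ne_top_of_le_ne_top (by simp) h1)
    obtain ⟨j', h2, h3, -⟩ := exists_of_adj (show G.Layer H u j a from hj.symm) hadj.symm
    have := h.unique h2
    rw [← hj] at h1
    have h1 : j ≤ i := by exact_mod_cast h1
    obtain rfl : j = i := by omega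
    exact hj.symm

lemma notMem (h : G.Layer H u (i + 1) w) : w ∉ H := by
  obtain ⟨a, ha, -⟩ := h.exists_pred
  exact ha.2.2

lemma notMem' (hu : u ∉ H) (h : G.Layer H u i w) : w ∉ H := by
  cases i with
  | zero => rwa [zero_iff.1 h]
  | succ i => exact h.notMem

lemma one_iff : G.Layer H u 1 w ↔ (G.avoiding H).Adj u w := by
  simp [Layer]

lemma not_adj (hu : u ∉ H) (h : G.Layer H u i a) (h' : G.Layer H u j b) (hij : j + 2 ≤ i) :
    ¬ G.Adj a b := by
  intro hab
  obtain ⟨j', h1, h2, h3⟩ := h.exists_of_adj ⟨hab, h.notMem' hu, h'.notMem' hu⟩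
  have := h1.unique h'
  omega

end Layer

/-! ### Attachments at distance at least four -/

/-- Distinct vertices with neighbours in `H` are at distance at least `k` outside `H`. -/
structure FarAttach (G : SimpleGraph V) (H : Set V) (k : ℕ) : Prop extends ClawTriFree G where
  nbr : ∀ {x}, x ∈ H → ∃ x' ∈ H, G.Adj x x'
  four_le : 4 ≤ k
  le : ∀ {u v i}, G.Attach H u → G.Attach H v → u ≠ v → G.Layer H u i v → k ≤ i

namespace FarAttach

variable {u v w a b c x z : V} {i j k m : ℕ}

lemma not_adj (h : G.FarAttach H k) (hu : G.Attach H u) (hw : G.Layer H u (i + 1) w)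
    (hi : i + 1 < k) (hz : z ∈ H) : ¬ G.Adj w z := by
  intro hwz
  have hne : u ≠ w := by
    rintro rfl
    have := hw.unique (Layer.zero_iff.2 rfl)
    omega
  have := h.le hu ⟨hw.notMem, z, hz, hwz⟩ hne hw
  omega

/-- Supplies the rear half of an induced path centred at `c`: two steps back towards `u`, continued
into `H` when `c` is too close to `u`. -/
lemma exists_back (h : G.FarAttach H k) (hu : G.Attach H u) (hc : G.Layer H u i c)
    (hi : i + 2 ≤ k) : ∃ z₁ z₂, G.Adj z₁ z₂ ∧ G.Adj z₂ c ∧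
      ∀ w, G.Layer H u (i + 1) w ∨ G.Layer H u (i + 2) w → ¬ G.Adj w z₁ ∧ ¬ (G.Adj w z₂) := by
  have hk := h.four_le
  obtain ⟨x, hx, hux⟩ := hu.2
  match i, hc with
  | 0, hc =>
    obtain rfl := Layer.zero_iff.1 hc
    obtain ⟨x', hx', hxx'⟩ := h.nbr hx
    refine ⟨x', x, hxx'.symm, hux.symm, ?_⟩
    rintro w (hw | hw)
    · exact ⟨h.not_adj hu hw (by omega) hx', h.not_adj hu hw (by omega) hx⟩
    · exact ⟨h.not_adj hu hw (by omega) hx', h.not_adj hu hw (by omega) hx⟩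
  -- Here `k ≥ 4` is essential: a vertex of layer three must not be an attachment, as it might be
  -- adjacent to `x`.
  | 1, hc =>
    have hu0 : G.Layer H u 0 u := Layer.zero_iff.2 rfl
    refine ⟨x, u, hux.symm, (Layer.one_iff.1 hc).1, ?_⟩
    rintro w (hw | hw)
    · exact ⟨h.not_adj hu hw (by omega) hx, hw.not_adj hu.1 hu0 (by omega)⟩
    · exact ⟨h.not_adj hu hw (by omega) hx, hw.not_adj hu.1 hu0 (by omega)⟩
  | i + 2, hc =>
    obtain ⟨z₂, h1, h2⟩ := hc.exists_pred
    obtain ⟨z₁, h3, h4⟩ := h2.exists_pred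
    refine ⟨z₁, z₂, h3.1, h1.1, ?_⟩
    rintro w (hw | hw)
    · exact ⟨hw.not_adj hu.1 h4 (by omega), hw.not_adj hu.1 h2 (by omega)⟩
    · exact ⟨hw.not_adj hu.1 h4 (by omega), hw.not_adj hu.1 h2 (by omega)⟩

/-- Consecutive layers are completely joined. -/
lemma adj_of_layer (h : G.FarAttach H k) (hu : G.Attach H u) (hi : i + 2 ≤ k)
    (ha : G.Layer H u (i + 1) a) (hb : G.Layer H u (i + 2) b) : G.Adj a b := by
  induction i generalizing a b with
  | zero =>
    obtain ⟨a₀, h1, h2⟩ := hb.exists_pred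
    obtain ⟨z₁, z₂, h3, h4, h5⟩ := h.exists_back hu (Layer.zero_iff.2 rfl) hi
    exact (h.claw h3 h4 (Layer.one_iff.1 h2).1 h1.1 (fun h' => (h5 _ (.inl h2)).1 h'.symm)
      (fun h' => (h5 _ (.inr hb)).2 h'.symm) (fun h' => (h5 _ (.inr hb)).1 h'.symm)
      (Layer.one_iff.1 ha).1).resolve_left (h5 _ (.inl ha)).1
  | succ i ih =>
    obtain ⟨a₀, h1, h2⟩ := hb.exists_pred
    obtain ⟨c, h6, h7⟩ := h2.exists_pred
    obtain ⟨z₁, z₂, h3, h4, h5⟩ := h.exists_back hu h7 hi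
    -- The path `z₁ z₂ c a₀ b` has centre `c`, which is adjacent to `a` by induction.
    exact (h.claw h3 h4 h6.1 h1.1 (fun h' => (h5 _ (.inl h2)).1 h'.symm)
      (fun h' => (h5 _ (.inr hb)).2 h'.symm) (fun h' => (h5 _ (.inr hb)).1 h'.symm)
      (ih (by omega) h7 ha)).resolve_left (h5 _ (.inl ha)).1

lemma not_adj_layer (h : G.FarAttach H k) (hu : G.Attach H u) (hi : i ≤ k)
    (ha : G.Layer H u i a) (hb : G.Layer H u i b) : ¬ G.Adj a b := by
  intro hab
  match i, ha, hb with
  | 0, ha, hb =>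
    rw [Layer.zero_iff.1 ha, Layer.zero_iff.1 hb] at hab
    exact hab.ne rfl
  | 1, ha, hb => exact h.tri (Layer.one_iff.1 ha).1 hab (Layer.one_iff.1 hb).1
  | i + 2, ha, hb =>
    obtain ⟨c, h1, h2⟩ := ha.exists_pred
    exact h.tri h1.1 hab (h.adj_of_layer hu hi h2 hb)

/-- Layers around `v` are completely joined too. A vertex `w` of the top layer is within distance
two of `v`; if it is at distance one or two, it is adjacent to `c` or `e` respectively, hence too
close to `u`. The same argument bounds the neighbours of `v`, so nothing lies beyond `v`. -/
lemma layer_top (h : G.FarAttach H (m + 3)) (hu : G.Attach H u) (hv : G.Attach H v)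
    (huv : G.Layer H u (m + 3) v) :
    (∀ w, G.Layer H u (m + 3) w → w = v) ∧ ∀ w, ¬ G.Layer H u (m + 4) w := by
  have hm := h.four_le
  obtain ⟨a, hav, ha⟩ := huv.exists_pred
  obtain ⟨c, hca, hc⟩ := ha.exists_pred
  obtain ⟨e, hec, he⟩ := hc.exists_pred
  have hva : G.Layer H v 1 a := Layer.one_iff.2 hav.symm
  have hvc : G.Layer H v 2 c := by
    obtain ⟨j, hj, hj', -⟩ := hva.exists_of_adj hca.symm
    have := huv.le_add hc hj
    obtain rfl : j = 2 := by omega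
    exact hj
  have hve : G.Layer H v 3 e := by
    obtain ⟨j, hj, hj', -⟩ := hvc.exists_of_adj hec.symm
    have := huv.le_add he hj
    obtain rfl : j = 3 := by omega
    exact hj
  have hnbr : ∀ w j, G.Layer H v 1 w → G.Layer H u j w → j ≤ m + 2 := by
    intro w j hw hj
    have hwc := h.adj_of_layer hv (by omega) hw hvc
    obtain ⟨j', h1, h2, -⟩ := hc.exists_of_adj ⟨hwc.symm, hca.2.1, hw.notMem⟩
    have := hj.unique h1
    omega
  have htop : ∀ w, G.Layer H u (m + 3) w → w = v := by
    intro w hw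
    obtain ⟨b, hbw, hb⟩ := hw.exists_pred
    have hbv := h.adj_of_layer hu le_rfl hb huv
    have hvb : G.Layer H v 1 b := Layer.one_iff.2 ⟨hbv.symm, hv.1, hbw.2.1⟩
    obtain ⟨j, hj, hj', -⟩ := hvb.exists_of_adj hbw
    match j, hj, hj' with
    | 0, hj, _ => exact Layer.zero_iff.1 hj
    | 1, hj, _ =>
      have := hnbr w _ hj hw
      omega
    | 2, hj, _ =>
      have hwe := h.adj_of_layer hv (by omega) hj hve
      obtain ⟨j', h1, h2, -⟩ := he.exists_of_adj ⟨hwe.symm, hec.2.1, hbw.2.2⟩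
      have := hw.unique h1
      omega
  refine ⟨htop, fun w hw => ?_⟩
  obtain ⟨b, hbw, hb⟩ := hw.exists_pred
  obtain rfl := htop b hb
  have := hnbr w _ (Layer.one_iff.2 hbw) hw
  omega

lemma exists_chainLabelling (h : G.FarAttach H k) (hSH : ∀ s ∈ S, s ∉ H) {a₀ : V} {l : List V}
    (hC : G.CycOn S n a₀ l) (huS : u ∈ S) (hu : G.Attach H u) (hv : G.Attach H v)
    (huv : G.Layer H u k v) :
    (∃ f, G.ChainLabelling S u v k f) ∧ ∀ w ∈ S, ∀ z ∈ H, G.Adj w z → w = u ∨ w = v := by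
  have hk := h.four_le
  obtain ⟨m, rfl⟩ : ∃ m, k = m + 3 := ⟨k - 3, by omega⟩
  obtain ⟨htop, habove⟩ := h.layer_top hu hv huv
  have hall : ∀ s ∈ S, ∃ j, G.Layer H u j s ∧ j ≤ m + 3 := by
    refine hC.forall_mem huS ⟨0, Layer.zero_iff.2 rfl, by omega⟩ ?_
    rintro x y ⟨j, hj, hjm⟩ hxy hy
    obtain ⟨j', h1, h2, -⟩ := hj.exists_of_adj ⟨hxy, hj.notMem' hu.1, hSH y hy⟩
    refine ⟨j', h1, ?_⟩
    by_contra hlt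
    obtain rfl : j' = m + 4 := by omega
    exact habove _ h1
  have hdist : ∀ {s j}, G.Layer H u j s → (G.avoiding H).dist u s = j := by
    intro s j hj
    unfold Layer at hj
    simp [dist, hj]
  refine ⟨⟨(G.avoiding H).dist u, ?_, by simp, hdist huv, ?_, ?_⟩, ?_⟩
  · intro a b ha hb hab
    obtain ⟨i, hi, him⟩ := hall a ha
    obtain ⟨j, hj, h1, h2⟩ := hi.exists_of_adj ⟨hab, hSH a ha, hSH b hb⟩
    have : i ≠ j := by
      rintro rfl
      exact h.not_adj_layer hu him hi hj hab
    rw [hdist hi, hdist hj]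
    omega
  · intro a ha hau hav
    obtain ⟨i, hi, him⟩ := hall a ha
    have h0 : i ≠ 0 := by
      rintro rfl
      exact hau (Layer.zero_iff.1 hi)
    have h1 : i ≠ m + 3 := by
      rintro rfl
      exact hav (htop a hi)
    rw [hdist hi]
    omega
  · intro a b ha hb h1 h2 h3
    obtain ⟨i, hi, -⟩ := hall a ha
    obtain ⟨j, hj, -⟩ := hall b hb
    rw [hdist hi] at h1
    rw [hdist hi, hdist hj] at h2
    rw [hdist hj] at h3
    obtain ⟨i, rfl⟩ : ∃ i', i = i' + 1 := ⟨i - 1, by omega⟩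
    subst h2
    exact h.adj_of_layer hu (by omega) hi hj
  · intro w hw z hz hwz
    obtain ⟨j, hj, hjm⟩ := hall w hw
    by_cases hwu : w = u
    · exact .inl hwu
    · have := h.le hu ⟨hSH w hw, z, hz, hwz⟩ (Ne.symm hwu) hj
      obtain rfl : j = m + 3 := by omega
      exact .inr (htop w hj)

end FarAttach

/-! ### The closest pair of attachments -/

lemma OffComponent.false (h : G.OffComponent S H n) {a₀ : V} {l : List V} (hC : G.CycOn S n a₀ l)
    {x₀ : V} (hx₀ : x₀ ∈ H) : False := by
  classical
  have hs := h.sparseAttach hC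
  have hSH : ∀ s ∈ S, s ∉ H := fun s hs hH => h.notMem hH hs
  have hex : ∃ i u v, G.Attach H u ∧ G.Attach H v ∧ u ≠ v ∧ G.Layer H u i v := by
    obtain ⟨u, v, hu, hv, huv, hux, hvy⟩ := h.exists_two_attach hC hx₀
    have : ∀ s ∈ S, ∃ j, G.Layer H u j s := by
      refine hC.forall_mem hu ⟨0, Layer.zero_iff.2 rfl⟩ ?_
      rintro x y ⟨j, hj⟩ hxy hy
      obtain ⟨j', h1, -⟩ := hj.exists_of_adj ⟨hxy, hj.notMem' (hSH u hu), hSH y hy⟩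
      exact ⟨j', h1⟩
    obtain ⟨j, hj⟩ := this v hv
    exact ⟨j, u, v, ⟨hSH u hu, hux⟩, ⟨hSH v hv, hvy⟩, huv, hj⟩
  obtain ⟨u, v, hu, hv, huv, hk⟩ := Nat.find_spec hex
  have hmin : ∀ u v i, G.Attach H u → G.Attach H v → u ≠ v → G.Layer H u i v →
      Nat.find hex ≤ i := fun _ _ _ hu hv huv hi => Nat.find_min' hex ⟨_, _, hu, hv, huv, hi⟩
  have huS := h.mem_of_attach hu
  have hvS := h.mem_of_attach hv
  obtain ⟨-, x, hx, hux⟩ := id hu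
  obtain ⟨-, y, hy, hvy⟩ := id hv
  generalize Nat.find hex = k at hk hmin
  match k, hk, hmin with
  | 0, hk, _ => exact huv (Layer.zero_iff.1 hk).symm
  | 1, hk, _ => exact hs.not_adj hu hv (Layer.one_iff.1 hk).1
  | 2, hk, _ =>
    obtain ⟨c, hcv, hc⟩ := hk.exists_pred
    exact hs.not_common hu hv huv hcv.2.1 (Layer.one_iff.1 hc).1 hcv.1.symm
  | 3, hk, _ =>
    obtain ⟨m, hmv, hm⟩ := hk.exists_pred
    obtain ⟨c, hcm, hc⟩ := hm.exists_pred
    obtain ⟨⟨f, hf⟩, hU⟩ := SparseAttach.ThreePath.exists_chainLabelling hs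
      ⟨hu, hv, huv, hcm.2.1, hmv.2.1, (Layer.one_iff.1 hc).1, hcm.1, hmv.1⟩ hSH hC huS
    exact h.not_chainLabelling hC huS hvS huv hx hy hux hvy hU hf
  | k + 4, hk, hmin =>
    have hfar : G.FarAttach H (k + 4) := ⟨h.toClawTriFree, h.nbr, by omega, hmin _ _ _⟩
    obtain ⟨⟨f, hf⟩, hU⟩ := hfar.exists_chainLabelling hSH hC huS hu hv hk
    exact h.not_chainLabelling hC huS hvS huv hx hy hux hvy hU hf

/-! ### From the hypotheses to the off-cycle component -/

lemma clawTriFree (hclaw : G.IsInducedFree clawStarStar)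
    (htri : G.IsInducedFree (completeGraph (Fin 3))) : G.ClawTriFree := by
  have tri : ∀ {a b c : V}, G.Adj a b → G.Adj b c → ¬ G.Adj a c := by
    intro a b c hab hbc hac
    refine htri ⟨⟨⟨![a, b, c], ?_⟩, ?_⟩⟩
    · intro i j hij
      have := hab.ne
      have := hbc.ne
      have := hac.ne
      fin_cases i <;> fin_cases j <;> simp_all
    · intro i j
      change G.Adj (![a, b, c] i) (![a, b, c] j) ↔ i ≠ j
      fin_cases i <;> fin_cases j <;>
        simp [ hab, hbc, hac, hab.symm, hbc.symm, hac.symm]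
  refine ⟨tri, ?_⟩
  intro b₁ a₁ c a₂ b₂ d h1 h2 h3 h4 h5 h6 h7 h8
  by_contra! hcon
  obtain ⟨h9, h10⟩ := hcon
  have k1 : ¬ G.Adj a₁ a₂ := tri h2 h3
  have k2 : ¬ G.Adj a₁ d := tri h2 h8
  have k3 : ¬ G.Adj a₂ d := tri h3.symm h8
  have k4 : ¬ G.Adj b₁ c := tri h1 h2
  have k5 : ¬ G.Adj c b₂ := tri h3 h4
  have hadj : ∀ i j, G.Adj (![c, a₁, a₂, d, b₁, b₂] i) (![c, a₁, a₂, d, b₁, b₂] j) ↔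
      clawStarStar.Adj i j := by
    have s5 := mt G.adj_symm h5
    have s6 := mt G.adj_symm h6
    have s7 := mt G.adj_symm h7
    have s9 := mt G.adj_symm h9
    have s10 := mt G.adj_symm h10
    have t1 := mt G.adj_symm k1
    have t2 := mt G.adj_symm k2
    have t3 := mt G.adj_symm k3
    have t4 := mt G.adj_symm k4
    have t5 := mt G.adj_symm k5
    intro i j
    fin_cases i <;> fin_cases j <;>
      simp [clawStarStar, *, h1.symm, h2.symm, h3.symm, h4.symm, h8.symm]
  refine hclaw ⟨⟨⟨![c, a₁, a₂, d, b₁, b₂], ?_⟩, hadj _ _⟩⟩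
  intro i j hij
  -- Distinct vertices of the prolonged claw have distinct neighbourhoods, so a map preserving and
  -- reflecting adjacency is injective.
  have hN : ∀ m, clawStarStar.Adj i m ↔ clawStarStar.Adj j m := fun m => by
    rw [← hadj, ← hadj, hij]
  have e0 := hN 0
  have e1 := hN 1
  have e2 := hN 2
  have e4 := hN 4
  have e5 := hN 5
  clear * - e0 e1 e2 e4 e5
  fin_cases i <;> fin_cases j <;> first | rfl | (exfalso; simp [clawStarStar] at e0 e1 e2 e4 e5)

lemma link_support {G' : SimpleGraph V} (hle : ∀ x y, G'.Adj x y → G.Adj x y) {x y a b : V}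
    (p : G'.Walk x y) (hax : G.Adj a x) (hyb : G.Adj y b) : G.Link a p.support b := by
  induction p generalizing a with
  | nil => simp [hax, hyb]
  | cons h q ih =>
    rw [Walk.support_cons, link_cons]
    exact ⟨hax, ih (hle _ _ h) hyb⟩

lemma IsTwoConnected.mem_of_closed (hconn : G.IsTwoConnected) {u s : V} {T : Set V} (hs : s ∈ T)
    (hsu : s ≠ u) (hT : ∀ a ∈ T, a ≠ u → ∀ b, G.Adj a b → b ≠ u → b ∈ T) {w : V} (hw : w ≠ u) :
    w ∈ T := by
  obtain ⟨p⟩ := (hconn.2 {u} (by simp)).preconnected ⟨s, hsu⟩ ⟨w, hw⟩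
  have key : ∀ {y z : (({u} : Set V)ᶜ : Set V)} (p : (G.induce ({u}ᶜ : Set V)).Walk y z),
      y.1 ∈ T → z.1 ∈ T := by
    intro y z p
    induction p with
    | nil => exact id
    | @cons y y' _ h q ih => exact fun hy => ih (hT _ hy y.2 _ h y'.2)
  exact key p hs

lemma avoiding_reachable_notMem {x w : V} (hx : x ∉ S) (h : (G.avoiding S).Reachable x w) :
    w ∉ S := by
  obtain ⟨p⟩ := h
  induction p with
  | nil => exact hx
  | cons h q ih => exact ih h.2.2

/-- The pairs of adjacent vertices off the list `l`. -/
def offPairs (G : SimpleGraph V) (l : List V) : Set (V × V) :=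
  {p | G.Adj p.1 p.2 ∧ p.1 ∉ l ∧ p.2 ∉ l}

lemma exists_optimal_cyc [Finite V] (h : ∃ a l, G.Cyc a l) :
    ∃ a l, G.Cyc a l ∧ (∀ a' l', G.Cyc a' l' → l'.length ≤ l.length) ∧
      ∀ a' l', G.Cyc a' l' → l'.length = l.length →
        (G.offPairs (a :: l)).ncard ≤ (G.offPairs (a' :: l')).ncard := by
  classical
  have hb : ∀ a l, G.Cyc a l → l.length ≤ Nat.card V := fun a l hl => by
    have := Fintype.ofFinite V
    rw [Nat.card_eq_fintype_card]
    exact (List.nodup_cons.1 hl.nodup).2.length_le_card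
  -- Minimising the deficit `k` maximises the length.
  have h1 : ∃ k a l, G.Cyc a l ∧ k + l.length = Nat.card V := by
    obtain ⟨a, l, hl⟩ := h
    exact ⟨Nat.card V - l.length, a, l, hl, Nat.sub_add_cancel (hb a l hl)⟩
  obtain ⟨a₁, l₁, hl₁, hk₁⟩ := Nat.find_spec h1
  have hmax : ∀ a' l', G.Cyc a' l' → l'.length ≤ l₁.length := fun a' l' hl' => by
    have := Nat.find_min' h1 ⟨a', l', hl', Nat.sub_add_cancel (hb a' l' hl')⟩
    have := hb a' l' hl'
    omega
  have h2 : ∃ k a l, G.Cyc a l ∧ l.length = l₁.length ∧ (G.offPairs (a :: l)).ncard = k :=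
    ⟨_, a₁, l₁, hl₁, rfl, rfl⟩
  obtain ⟨a, l, hl, hlen, hk⟩ := Nat.find_spec h2
  refine ⟨a, l, hl, fun a' l' hl' => hlen ▸ hmax a' l' hl', fun a' l' hl' hlen' => ?_⟩
  rw [hk]
  exact Nat.find_min' h2 ⟨a', l', hl', hlen'.trans hlen, rfl⟩

lemma offComponent [Finite V] (hconn : G.IsTwoConnected) (hfree : G.ClawTriFree) {a₀ : V}
    {l₀ : List V} (hmax : ∀ a' l', G.Cyc a' l' → l'.length ≤ l₀.length)
    (hmin : ∀ a' l', G.Cyc a' l' → l'.length = l₀.length →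
        (G.offPairs (a₀ :: l₀)).ncard ≤ (G.offPairs (a' :: l')).ncard) {x₀ y₀ : V}
    (hx₀ : x₀ ∉ a₀ :: l₀) (hy₀ : y₀ ∉ a₀ :: l₀) (hxy : G.Adj x₀ y₀) :
    G.OffComponent {w | w ∈ a₀ :: l₀} {w | (G.avoiding {w | w ∈ a₀ :: l₀}).Reachable x₀ w}
      l₀.length where
  toClawTriFree := hfree
  longest := fun h => hmax _ _ h
  exchange := by
    intro a l w x x' hl hlen hw hnbr hsub hxl hx hx' hxx'
    -- Only `w` can leave the cycle, and its neighbours all lie on the new one, so no off-cycle edge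
    -- appears, while `x x'` disappears.
    refine (Set.ncard_lt_ncard ?_ (Set.toFinite _)).not_ge (hmin a l hl hlen)
    have hoff : ∀ {z}, z ∉ a :: l → z ∈ a₀ :: l₀ → z = w := fun {z} hz hz₀ => by
      by_contra hne
      exact hz (hsub z hz₀ hne)
    rw [Set.ssubset_iff_of_subset]
    · exact ⟨(x, x'), ⟨hxx', hx, hx'⟩, fun hh => hh.2.1 hxl⟩
    · rintro ⟨p, q⟩ ⟨hpq, hp, hq⟩
      simp only at hpq hp hq
      refine ⟨hpq, fun hp₀ => ?_, fun hq₀ => ?_⟩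
      · obtain rfl := hoff hp hp₀
        by_cases hq₀ : q ∈ a₀ :: l₀
        · exact hpq.ne (hoff hq hq₀).symm
        · exact hnbr q hq₀ hpq
      · obtain rfl := hoff hq hq₀
        by_cases hp₀ : p ∈ a₀ :: l₀
        · exact hpq.ne (hoff hp hp₀)
        · exact hnbr p hp₀ hpq.symm
  notMem := fun h => avoiding_reachable_notMem hx₀ h
  closed := fun {x y} hx hadj hy =>
    hx.trans (Adj.reachable ⟨hadj, avoiding_reachable_notMem hx₀ hx, hy⟩)
  link := by
    classical
    intro x y a b hx hy hax hyb
    obtain ⟨p, hp⟩ := (hx.symm.trans hy).exists_isPath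
    refine ⟨p.support, link_support (G' := G.avoiding _) (fun _ _ h => h.1) p hax hyb, hp.support_nodup, ?_, by simp,
      by simp, ?_⟩
    · intro z hz
      exact hx.trans ⟨p.takeUntil z hz⟩
    · intro hne
      have : p.length ≠ 0 := fun h0 => hne (Walk.eq_of_length_eq_zero h0)
      rw [Walk.length_support]
      omega
  nbr := by
    rintro x hx
    obtain ⟨p⟩ := hx.symm
    cases p with
    | nil => exact ⟨y₀, Adj.reachable ⟨hxy, hx₀, hy₀⟩, hxy⟩
    | cons h q => exact ⟨_, q.reachable.symm, h.1⟩
  cut := fun hs hsu hT w hw => hconn.mem_of_closed hs hsu hT hw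

end SimpleGraph

theorem theorem6 {V : Type*} [Finite V] (G : SimpleGraph V)
    (hconn : G.IsTwoConnected)
    (hclaw : G.IsInducedFree SimpleGraph.clawStarStar)
    (htri : G.IsInducedFree (SimpleGraph.completeGraph (Fin 3))) :
    ∃ (u : V) (C : G.Walk u u), C.IsLongestCycle ∧ C.IsDominating := by
  obtain ⟨a, l, hl, hmax, hmin⟩ :=
    SimpleGraph.exists_optimal_cyc (SimpleGraph.exists_cyc hconn)
  obtain ⟨C, hC, hsupp⟩ := hl.exists_walk
  refine ⟨a, C, ⟨hC, ?_⟩, ?_⟩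
  · intro v D hD
    obtain ⟨l', hl', hsupp'⟩ := SimpleGraph.cyc_of_isCycle hD
    have h1 := hmax _ _ hl'
    have h2 := congrArg List.length hsupp
    have h3 := congrArg List.length hsupp'
    simp at h2 h3
    omega
  · intro e he
    by_contra! hcon
    induction e with
    | _ x y =>
      have hmem : ∀ z ∈ a :: l, z ∈ C.support := fun z hz => by
        rw [hsupp, ← List.cons_append]
        exact List.mem_append_left _ hz
      have h := SimpleGraph.offComponent hconn (SimpleGraph.clawTriFree hclaw htri) hmax hmin
        (fun hx => hcon x (hmem x hx) (by simp)) (fun hy => hcon y (hmem y hy) (by simp)) he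
      exact h.false ⟨hl, fun _ => Iff.rfl, rfl⟩ (SimpleGraph.Reachable.refl x)
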